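/- All functions are real-valued Lebesgue measurable functions on $(0,\infty)$, identified when they agree almost everywhere; $f^*(t)=\inf\{s\ge 0: |\{x>0:|f(x)|>s\}|\le t\}$ is the decreasing rearrangement of $f$. A function $\varphi$ is quasi-concave if $\varphi(0)=0$, $\varphi(t)>0$ for $t>0$, $\varphi$ is increasing on $(0,\infty)$ and $\varphi(t)/t$ is decreasing on $(0,\infty)$ (both in the wide sense). For such $\varphi$, the minimal Lorentz space is $$\Lambda_\varphi=\Big\{f:\ \|f\|_{\Lambda_\varphi}=\int_{[0,\infty)} f^*(t)\,d\varphi(t)<\infty\Big\},$$ where $d\varphi$ is the Lebesgue–Stieltjes measure of $\varphi$, including the atom $\varphi(0+)$ at $0$ if $\varphi(0+)>0$. A rearrangement invariant (r.i.) quasi-Banach space is a vector space $X$ of functions with a complete quasi-norm $\|\cdot\|_X$, containing the characteristic functions of all sets of finite measure, such that if $g\in X$ and either $|f|\le|g|$ a.e. or $f$ and $g$ are equimeasurable, then $f\in X$ and $\|f\|_X\le\|g\|_X$. Let $Sf(t)=\frac1t\int_0^t f(r)\,dr$ be the Hardy operator. The optimal range $\mathfrak{R}_q[S,\Lambda_\varphi]$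 is the smallest r.i. quasi-Banach space $X$ such that $S:\Lambda_\varphi\to X$ is bounded: $S:\Lambda_\varphi\to X$ is bounded, and $X$ is continuously included in every r.i. quasi-Banach space $Z$ for which $S:\Lambda_\varphi\to Z$ is bounded. (When it exists, it is unique up to equivalence of quasi-norms.) For an r.i. quasi-Banach space $X$ containing the function $s\mapsto 1/(1+s)$, the function $$W_X(t)=\Big\|\frac{1}{1+\cdot/t}\Big\|_X,\qquad t>0,$$ (with $W_X(0)=0$) is quasi-concave, and $R(X)$ denotes the Lorentz space $\Lambda_{W_X}$. **Theorem 3.3.** Let $\varphi$ be quasi-concave. Then the optimal range $\mathfrak{R}_q[S,\Lambda_\varphi]$ exists, it contains $1/(1+s)$, and $$R(\mathfrak{R}_q[S,\Lambda_\varphi])=\Lambda_\varphi,$$ that is, the two Lorentz spaces consist of the same functions and their norms are equivalent. -/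

import Mathlib

open MeasureTheory Set Filter Topology
open scoped NNReal ENNReal

namespace RestrictedType

noncomputable section

/-- Lebesgue measure on the half-line `(0, ∞)`. -/
def halfLine : Measure ℝ := volume.restrict (Ioi (0 : ℝ))

/-- The decreasing rearrangement `f^*(t) = inf {s ≥ 0 : |{x > 0 : |f x| > s}| ≤ t}`, for `t ≥ 0`, as
an extended number. In particular `f^*(0)` is the essential supremum of `|f|`. -/
def rearr (f : ℝ → ℝ) (t : ℝ) : ℝ≥0∞ :=
  sInf {s : ℝ≥0∞ | halfLine {x | s < ‖f x‖ₑ} ≤ ENNReal.ofReal t}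

/-- Two functions on `(0, ∞)` with the same distribution function. -/
def Equimeasurable (f g : ℝ → ℝ) : Prop :=
  ∀ s : ℝ≥0, halfLine {x | (s : ℝ) < |f x|} = halfLine {x | (s : ℝ) < |g x|}

/-- Quasi-concave functions on `(0, ∞)`. Only the values at `t > 0` matter; at `0` the function is
understood to vanish. "Increasing" and "decreasing" are meant in the wide sense. -/
structure QuasiConcave where
  toFun : ℝ → ℝ
  pos : ∀ t, 0 < t → 0 < toFun t
  mono : ∀ s t, 0 < s → s ≤ t → toFun s ≤ toFun t
  div_anti : ∀ s t, 0 < s → s ≤ t → toFun t / t ≤ toFun s / s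

/-- The extension of `φ` to the line by `0` on `(-∞, 0]`. -/
def QuasiConcave.ext (φ : QuasiConcave) (t : ℝ) : ℝ := if 0 < t then φ.toFun t else 0

theorem QuasiConcave.ext_mono (φ : QuasiConcave) : Monotone φ.ext := by
  intro s t hst
  unfold QuasiConcave.ext
  by_cases hs : 0 < s
  · rw [if_pos hs, if_pos (hs.trans_le hst)]
    exact φ.mono s t hs hst
  · rw [if_neg hs]
    by_cases ht : 0 < t
    · rw [if_pos ht]
      exact (φ.pos t ht).le
    · rw [if_neg ht]

/-- The Lebesgue-Stieltjes measure `dφ` on `[0, ∞)`, which has the atom `φ(0+)` at `0`, as it is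
usual. (It gives no mass to `(-∞, 0)`.) -/
def QuasiConcave.stieltjes (φ : QuasiConcave) : Measure ℝ :=
  φ.ext_mono.stieltjesFunction.measure

/-- The norm `∫_[0,∞) f^*(t) dφ(t)` of the minimal Lorentz space `Λ_φ`. -/
def lorentzNorm (φ : QuasiConcave) (f : ℝ → ℝ) : ℝ≥0∞ :=
  ∫⁻ t in Ici (0 : ℝ), rearr f t ∂φ.stieltjes

/-- The minimal Lorentz space `Λ_φ` on `(0, ∞)`. -/
def lorentzSpace (φ : QuasiConcave) : Set (ℝ → ℝ) :=
  {f | AEMeasurable f halfLine ∧ lorentzNorm φ f < ∞}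

/-- Rearrangement invariant quasi-Banach function spaces on `(0, ∞)`, presented by their quasi-norm,
which is extended by the value `∞` to the measurable functions outside of the space. Functions that
agree almost everywhere are identified (by `mono`, they have the same quasi-norm). -/
structure RIQuasiBanach where
  nrm : (ℝ → ℝ) → ℝ≥0∞
  nrm_eq_zero : ∀ f, AEMeasurable f halfLine → (nrm f = 0 ↔ f =ᵐ[halfLine] 0)
  nrm_smul : ∀ (c : ℝ) (f : ℝ → ℝ), AEMeasurable f halfLine →
    nrm (fun x => c * f x) = ‖c‖ₑ * nrm f
  quasi_triangle : ∃ K : ℝ≥0, ∀ f g : ℝ → ℝ, AEMeasurable f halfLine → AEMeasurable g halfLine →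
    nrm (fun x => f x + g x) ≤ K * (nrm f + nrm g)
  mono : ∀ f g : ℝ → ℝ, AEMeasurable f halfLine → AEMeasurable g halfLine →
    (∀ᵐ x ∂halfLine, |f x| ≤ |g x|) → nrm f ≤ nrm g
  rearrangement_invariant : ∀ f g : ℝ → ℝ, AEMeasurable f halfLine → AEMeasurable g halfLine →
    Equimeasurable f g → nrm f = nrm g
  nrm_indicator_lt_top : ∀ E : Set ℝ, MeasurableSet E → halfLine E < ∞ →
    nrm (E.indicator fun _ => 1) < ∞
  complete : ∀ u : ℕ → ℝ → ℝ, (∀ n, AEMeasurable (u n) halfLine ∧ nrm (u n) < ∞) →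
    (∀ ε : ℝ≥0∞, 0 < ε → ∃ N, ∀ m ≥ N, ∀ n ≥ N, nrm (fun x => u m x - u n x) < ε) →
    ∃ f, (AEMeasurable f halfLine ∧ nrm f < ∞) ∧
      Tendsto (fun n => nrm (fun x => u n x - f x)) atTop (𝓝 0)

/-- The functions that belong to the space. -/
def RIQuasiBanach.space (X : RIQuasiBanach) : Set (ℝ → ℝ) :=
  {f | AEMeasurable f halfLine ∧ X.nrm f < ∞}

/-- The Hardy operator `Sf(t) = (1/t) ∫_0^t f(r) dr`, `t > 0`. -/
def hardy (f : ℝ → ℝ) (t : ℝ) : ℝ := 1 / t * ∫ r in (0 : ℝ)..t, f r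

/-- `S : Λ_φ → X` is bounded. -/
def HardyBounded (φ : QuasiConcave) (X : RIQuasiBanach) : Prop :=
  ∃ C : ℝ≥0, ∀ f ∈ lorentzSpace φ, hardy f ∈ X.space ∧ X.nrm (hardy f) ≤ C * lorentzNorm φ f

/-- `X` is contained in `Z`, with continuous inclusion. -/
def Embeds (X Z : RIQuasiBanach) : Prop :=
  ∃ C : ℝ≥0, ∀ f ∈ X.space, f ∈ Z.space ∧ Z.nrm f ≤ C * X.nrm f

/-- `X` is the optimal range of the Hardy operator on `Λ_φ`: the smallest rearrangement invariant
quasi-Banach function space `X` such that `S : Λ_φ → X` is bounded. (This determines `X` up to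
equivalence of quasi-norms.) -/
def IsOptimalRange (φ : QuasiConcave) (X : RIQuasiBanach) : Prop :=
  HardyBounded φ X ∧ ∀ Z : RIQuasiBanach, HardyBounded φ Z → Embeds X Z

/-- The function `E_{1/t} g`, that is `s ↦ 1 / (1 + s / t)`, where `g(s) = 1 / (1 + s)`. -/
def dilG (t s : ℝ) : ℝ := 1 / (1 + s / t)

theorem aemeasurable_dilG (t : ℝ) : AEMeasurable (dilG t) halfLine := by
  unfold dilG
  fun_prop

theorem ae_halfLine_pos : ∀ᵐ x ∂halfLine, 0 < x :=
  ae_restrict_mem measurableSet_Ioi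

theorem dilG_mono {r t : ℝ} (X : RIQuasiBanach) (hr : 0 < r) (hrt : r ≤ t) :
    X.nrm (dilG r) ≤ X.nrm (dilG t) := by
  refine X.mono _ _ (aemeasurable_dilG r) (aemeasurable_dilG t) ?_
  filter_upwards [ae_halfLine_pos] with x hx
  have ht : 0 < t := hr.trans_le hrt
  unfold dilG
  rw [abs_of_pos (by positivity), abs_of_pos (by positivity)]
  gcongr

theorem dilG_le_smul {r t : ℝ} (X : RIQuasiBanach) (hr : 0 < r) (hrt : r ≤ t) :
    X.nrm (dilG t) ≤ ENNReal.ofReal (t / r) * X.nrm (dilG r) := by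
  have ht : 0 < t := hr.trans_le hrt
  have h1 := X.nrm_smul (t / r) (dilG r) (aemeasurable_dilG r)
  rw [Real.enorm_of_nonneg (by positivity)] at h1
  rw [← h1]
  refine X.mono _ _ (aemeasurable_dilG t) ((aemeasurable_dilG r).const_mul _) ?_
  filter_upwards [ae_halfLine_pos] with x hx
  unfold dilG
  rw [abs_of_pos (by positivity), abs_of_pos (by positivity)]
  have e1 : 1 / (1 + x / t) = t * (1 / (t + x)) := by field_simp
  have e2 : t / r * (1 / (1 + x / r)) = t * (1 / (r + x)) := by field_simp
  rw [e1, e2]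
  gcongr

theorem dilG_ne_top (X : RIQuasiBanach) (h : dilG 1 ∈ X.space) {t : ℝ} (ht : 0 < t) :
    X.nrm (dilG t) ≠ ∞ := by
  rcases le_total t 1 with h1 | h1
  · exact ((dilG_mono X ht h1).trans_lt h.2).ne
  · exact ((dilG_le_smul X one_pos h1).trans_lt (ENNReal.mul_lt_top ENNReal.ofReal_lt_top h.2)).ne

/-- The function `W_X(t) = ‖1 / (1 + · / t)‖_X`, which is quasi-concave, for a space `X` that contains
the function `1 / (1 + s)`. -/
def RIQuasiBanach.W (X : RIQuasiBanach) (h : dilG 1 ∈ X.space) : QuasiConcave where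
  toFun t := (X.nrm (dilG t)).toReal
  pos t ht := by
    refine ENNReal.toReal_pos (fun h0 => ?_) (dilG_ne_top X h ht)
    rw [X.nrm_eq_zero _ (aemeasurable_dilG t)] at h0
    have hF : ∀ᵐ x ∂halfLine, False := by
      filter_upwards [h0, ae_halfLine_pos] with x hx hx0
      have : 0 < dilG t x := by
        unfold dilG
        positivity
      exact this.ne' hx
    rw [eventually_false_iff_eq_bot, ae_eq_bot, halfLine, Measure.restrict_eq_zero,
      Real.volume_Ioi] at hF
    exact ENNReal.top_ne_zero hF
  mono r t hr hrt := ENNReal.toReal_mono (dilG_ne_top X h (hr.trans_le hrt)) (dilG_mono X hr hrt)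
  div_anti r t hr hrt := by
    have ht : 0 < t := hr.trans_le hrt
    have h1 := ENNReal.toReal_mono
      (ENNReal.mul_ne_top ENNReal.ofReal_ne_top (dilG_ne_top X h hr)) (dilG_le_smul X hr hrt)
    rw [ENNReal.toReal_mul, ENNReal.toReal_ofReal (by positivity)] at h1
    rw [div_le_iff₀ ht]
    refine h1.trans (le_of_eq ?_)
    ring

/-- `Λ_φ = Λ_ψ`: the two Lorentz spaces have the same elements, and equivalent norms. -/
def SameLorentz (φ ψ : QuasiConcave) : Prop :=
  lorentzSpace φ = lorentzSpace ψ ∧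
    ∃ C : ℝ≥0, ∀ f ∈ lorentzSpace φ,
      lorentzNorm φ f ≤ C * lorentzNorm ψ f ∧ lorentzNorm ψ f ≤ C * lorentzNorm φ f

end

end RestrictedType

namespace RestrictedType

noncomputable section

theorem halfLine_apply (A : Set ℝ) : halfLine A = volume (A ∩ Ioi 0) :=
  Measure.restrict_apply' measurableSet_Ioi

theorem halfLine_ofReal_lt (a : ℝ≥0∞) : halfLine {s | ENNReal.ofReal s < a} = a := by
  rw [halfLine_apply]
  induction a with
  | top =>
    have : {s : ℝ | ENNReal.ofReal s < ∞} ∩ Ioi 0 = Ioi 0 := by ext; simp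
    rw [this, Real.volume_Ioi]
  | coe a =>
    have : {s : ℝ | ENNReal.ofReal s < a} ∩ Ioi 0 = Ioo 0 (a : ℝ) := by
      ext s
      simp only [mem_inter_iff, mem_ofPred_eq, mem_Ioi, mem_Ioo]
      constructor
      · rintro ⟨h, h0⟩
        exact ⟨h0, by simpa using (ENNReal.ofReal_lt_iff_lt_toReal h0.le ENNReal.coe_ne_top).1 h⟩
      · rintro ⟨h0, h⟩
        exact ⟨(ENNReal.ofReal_lt_iff_lt_toReal h0.le ENNReal.coe_ne_top).2 (by simpa using h), h0⟩
    rw [this, Real.volume_Ioo]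
    simp

instance : SFinite halfLine := by unfold halfLine; infer_instance

/-- The layer cake formula for functions with values in `[0, ∞]`. -/
theorem lintegral_eq_lintegral_superlevel {α : Type*} [MeasurableSpace α] {μ : Measure α} [SFinite μ]
    {F : α → ℝ≥0∞} (hF : AEMeasurable F μ) :
    ∫⁻ x, F x ∂μ = ∫⁻ s, μ {x | ENNReal.ofReal s < F x} ∂halfLine := by
  wlog hm : Measurable F generalizing F
  · rw [lintegral_congr_ae hF.ae_eq_mk, this hF.measurable_mk.aemeasurable hF.measurable_mk]
    refine lintegral_congr fun s => measure_congr ?_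
    filter_upwards [hF.ae_eq_mk] with x hx
    apply propext
    change ENNReal.ofReal s < _ ↔ ENNReal.ofReal s < _
    rw [hx]
  have hset : MeasurableSet {p : α × ℝ | ENNReal.ofReal p.2 < F p.1} :=
    measurableSet_lt (by fun_prop) (by fun_prop)
  have h1 : ∀ x, F x =
      ∫⁻ s, {p : α × ℝ | ENNReal.ofReal p.2 < F p.1}.indicator 1 (x, s) ∂halfLine := by
    intro x
    have : (fun s => {p : α × ℝ | ENNReal.ofReal p.2 < F p.1}.indicator (1 : α × ℝ → ℝ≥0∞) (x, s)) =
        {s : ℝ | ENNReal.ofReal s < F x}.indicator 1 := rfl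
    rw [this, lintegral_indicator_one (measurableSet_lt (by fun_prop) (by fun_prop)),
      halfLine_ofReal_lt]
  have h2 : ∀ s, μ {x | ENNReal.ofReal s < F x} =
      ∫⁻ x, {p : α × ℝ | ENNReal.ofReal p.2 < F p.1}.indicator 1 (x, s) ∂μ := by
    intro s
    have : (fun x => {p : α × ℝ | ENNReal.ofReal p.2 < F p.1}.indicator (1 : α × ℝ → ℝ≥0∞) (x, s)) =
        {x : α | ENNReal.ofReal s < F x}.indicator 1 := rfl
    rw [this, lintegral_indicator_one (measurableSet_lt (by fun_prop) (by fun_prop))]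
  simp_rw [h2]
  rw [lintegral_congr h1]
  exact lintegral_lintegral_swap (measurable_one.indicator hset).aemeasurable

/-- An estimate for the measures of superlevel sets gives the same estimate for integrals. -/
theorem lintegral_le_of_superlevel_le {α β : Type*} [MeasurableSpace α] [MeasurableSpace β]
    {μ : Measure α} {ν : Measure β} [SFinite μ] [SFinite ν] {F : α → ℝ≥0∞} {G : β → ℝ≥0∞}
    (hF : AEMeasurable F μ) (hG : AEMeasurable G ν) {C : ℝ≥0∞} (hC : C ≠ ∞)
    (h : ∀ s, μ {x | s < F x} ≤ C * ν {x | s < G x}) :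
    ∫⁻ x, F x ∂μ ≤ C * ∫⁻ x, G x ∂ν := by
  rw [lintegral_eq_lintegral_superlevel hF, lintegral_eq_lintegral_superlevel hG,
    ← lintegral_const_mul' _ _ hC]
  exact lintegral_mono fun s => h _

/-- The decreasing rearrangement of a function with values in `[0, ∞]`. -/
def decr (F : ℝ → ℝ≥0∞) (t : ℝ) : ℝ≥0∞ :=
  sInf {s : ℝ≥0∞ | halfLine {x | s < F x} ≤ ENNReal.ofReal t}

theorem rearr_eq_decr (f : ℝ → ℝ) : rearr f = decr fun x => ‖f x‖ₑ := rfl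

theorem halfLine_decr_lt_le (F : ℝ → ℝ≥0∞) (t : ℝ) :
    halfLine {x | decr F t < F x} ≤ ENNReal.ofReal t := by
  obtain ⟨u, hu, hlim, hmem⟩ := exists_seq_tendsto_sInf
    (S := {s : ℝ≥0∞ | halfLine {x | s < F x} ≤ ENNReal.ofReal t}) ⟨∞, by simp⟩ (OrderBot.bddBelow _)
  have hsub : {x | decr F t < F x} ⊆ ⋃ n, {x | u n < F x} := by
    intro x hx
    obtain ⟨n, hn⟩ := (hlim.eventually (gt_mem_nhds hx)).exists
    exact mem_iUnion.2 ⟨n, hn⟩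
  have hmono : Monotone fun n => {x | u n < F x} := fun m n hmn x hx => (hu hmn).trans_lt hx
  refine (measure_mono hsub).trans ?_
  rw [hmono.measure_iUnion]
  exact iSup_le hmem

theorem lt_decr_iff {F : ℝ → ℝ≥0∞} {s : ℝ≥0∞} {t : ℝ} :
    s < decr F t ↔ ENNReal.ofReal t < halfLine {x | s < F x} := by
  constructor
  · intro h
    by_contra! h'
    exact (show decr F t ≤ s from sInf_le h').not_gt h
  · intro h
    by_contra! h'
    exact ((measure_mono fun x hx => h'.trans_lt hx).trans (halfLine_decr_lt_le F t)).not_gt h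

theorem decr_le_iff {F : ℝ → ℝ≥0∞} {s : ℝ≥0∞} {t : ℝ} :
    decr F t ≤ s ↔ halfLine {x | s < F x} ≤ ENNReal.ofReal t := by
  simpa using not_congr (lt_decr_iff (F := F) (s := s) (t := t))

theorem decr_antitone (F : ℝ → ℝ≥0∞) : Antitone (decr F) := fun _ _ h =>
  decr_le_iff.2 ((halfLine_decr_lt_le F _).trans (ENNReal.ofReal_le_ofReal h))

theorem decr_mono_ae {F G : ℝ → ℝ≥0∞} (h : F ≤ᵐ[halfLine] G) (t : ℝ) : decr F t ≤ decr G t := by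
  refine decr_le_iff.2 ((measure_mono_ae ?_).trans (halfLine_decr_lt_le G t))
  filter_upwards [h] with x hx hx'
  exact lt_of_lt_of_le hx' hx

/-- The rearrangement of `F` is dominated by every decreasing majorant of `F`. -/
theorem decr_le_of_le {F Q : ℝ → ℝ≥0∞} {t : ℝ} (h : ∀ x, 0 < x → t ≤ x → F x ≤ Q t) :
    decr F t ≤ Q t := by
  refine decr_le_iff.2 ?_
  rw [halfLine_apply]
  have : {x | Q t < F x} ∩ Ioi 0 ⊆ Ioo 0 t := by
    rintro x ⟨hx, hx0⟩
    refine ⟨hx0, ?_⟩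
    by_contra! h'
    exact (h x hx0 h').not_gt hx
  refine (measure_mono this).trans ?_
  simp

theorem le_decr_of_le {F : ℝ → ℝ≥0∞} {t r : ℝ} (ht : 0 ≤ t) (htr : t < r) {c : ℝ≥0∞}
    (h : ∀ x ∈ Ioo 0 r, c ≤ F x) : c ≤ decr F t := by
  refine le_of_forall_lt fun s hs => lt_decr_iff.2 ?_
  have : Ioo 0 r ⊆ {x | s < F x} ∩ Ioi 0 := fun x hx => ⟨hs.trans_le (h x hx), hx.1⟩
  rw [halfLine_apply]
  refine lt_of_lt_of_le ?_ (measure_mono this)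
  rw [Real.volume_Ioo, sub_zero]
  exact (ENNReal.ofReal_lt_ofReal_iff (ht.trans_lt htr)).2 htr

theorem decr_smul_le {F : ℝ → ℝ≥0∞} (c : ℝ≥0∞) (t : ℝ) :
    decr (fun x => c * F x) t ≤ c * decr F t := by
  refine decr_le_iff.2 ((measure_mono fun x hx => ?_).trans (halfLine_decr_lt_le F t))
  by_contra h
  exact (mul_le_mul_right (not_lt.1 h) c).not_gt hx

theorem decr_tsum_le (F : ℕ → ℝ → ℝ≥0∞) {t : ℝ} (ht : 0 ≤ t) :
    decr (fun x => ∑' j, F j x) t ≤ ∑' j, decr (F j) (t / 2 / 2 ^ j) := by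
  refine decr_le_iff.2 ?_
  have hsub : {x | ∑' j, decr (F j) (t / 2 / 2 ^ j) < ∑' j, F j x} ⊆
      ⋃ j, {x | decr (F j) (t / 2 / 2 ^ j) < F j x} := by
    intro x hx
    by_contra h
    simp only [mem_iUnion, mem_ofPred_eq, not_exists, not_lt] at h
    exact (ENNReal.tsum_le_tsum h).not_gt hx
  calc _ ≤ _ := measure_mono hsub
    _ ≤ _ := measure_iUnion_le _
    _ ≤ ∑' j : ℕ, ENNReal.ofReal (t / 2 / 2 ^ j) :=
      ENNReal.tsum_le_tsum fun j => halfLine_decr_lt_le _ _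
    _ = ENNReal.ofReal t := by
      rw [← ENNReal.ofReal_tsum_of_nonneg (fun j => by positivity) (summable_geometric_two' t),
        tsum_geometric_two']

theorem ae_lt_top_of_decr_lt_top {F : ℝ → ℝ≥0∞} (h : ∀ t, 0 < t → decr F t < ∞) :
    ∀ᵐ x ∂halfLine, F x < ∞ := by
  rw [ae_iff]
  refine le_antisymm (ENNReal.le_of_forall_pos_le_add fun ε hε _ => ?_) zero_le
  rw [zero_add]
  have h1 := halfLine_decr_lt_le F ε
  rw [ENNReal.ofReal_coe_nnreal] at h1
  refine (measure_mono fun x hx => ?_).trans h1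
  have hx' : F x = ∞ := by simpa using hx
  rw [mem_ofPred_eq, hx']
  exact h _ hε

theorem ae_eq_zero_of_decr_eq_zero {F : ℝ → ℝ≥0∞} (h : ∀ t, 0 < t → decr F t = 0) :
    ∀ᵐ x ∂halfLine, F x = 0 := by
  rw [ae_iff]
  refine le_antisymm (ENNReal.le_of_forall_pos_le_add fun ε hε _ => ?_) zero_le
  rw [zero_add]
  have h1 := halfLine_decr_lt_le F ε
  rw [h _ (NNReal.coe_pos.2 hε), ENNReal.ofReal_coe_nnreal] at h1
  exact (measure_mono fun x hx => pos_iff_ne_zero.2 hx).trans h1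

/-- The average of `H` over `(0, t)`, for functions with values in `[0, ∞]`. -/
def avg (H : ℝ → ℝ≥0∞) (t : ℝ) : ℝ≥0∞ := ∫⁻ u in Ioo (0 : ℝ) 1, H (t * u)

theorem avg_antitone {H : ℝ → ℝ≥0∞} (hH : Antitone H) : Antitone (avg H) := by
  intro s t hst
  refine setLIntegral_mono' measurableSet_Ioo fun u hu => hH ?_
  exact mul_le_mul_of_nonneg_right hst hu.1.le

theorem le_avg {H : ℝ → ℝ≥0∞} (hH : Antitone H) {t : ℝ} (ht : 0 < t) : H t ≤ avg H t := by
  calc H t = ∫⁻ _ in Ioo (0 : ℝ) 1, H t := by simp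
    _ ≤ _ := setLIntegral_mono' measurableSet_Ioo fun u hu => hH (by nlinarith [hu.1, hu.2])

theorem setLIntegral_Ioo_eq_avg (H : ℝ → ℝ≥0∞) {t : ℝ} (ht : 0 < t) :
    ∫⁻ x in Ioo 0 t, H x = ENNReal.ofReal t * avg H t := by
  rw [avg, ← lintegral_indicator measurableSet_Ioo, ← lintegral_indicator measurableSet_Ioo]
  conv_lhs => rw [← Real.smul_map_volume_mul_left ht.ne']
  have he : MeasurableEmbedding (fun x : ℝ => t * x) := (Homeomorph.mulLeft₀ t ht.ne').measurableEmbedding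
  rw [lintegral_smul_measure, he.lintegral_map, abs_of_pos ht, smul_eq_mul]
  congr 2
  ext u
  have : t * u ∈ Ioo 0 t ↔ u ∈ Ioo (0 : ℝ) 1 := by
    simp only [mem_Ioo]
    constructor
    · rintro ⟨h1, h2⟩
      exact ⟨pos_of_mul_pos_right h1 ht.le, by nlinarith⟩
    · rintro ⟨h1, h2⟩
      exact ⟨by positivity, by nlinarith⟩
  simp only [indicator, this]

theorem avg_div_le (H : ℝ → ℝ≥0∞) {t c : ℝ} (ht : 0 < t) (hc : 1 ≤ c) :
    avg H (t / c) ≤ ENNReal.ofReal c * avg H t := by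
  have hc0 : 0 < c := by linarith
  have h1 := setLIntegral_Ioo_eq_avg H (t := t / c) (by positivity)
  have h2 := setLIntegral_Ioo_eq_avg H ht
  have h3 : ∫⁻ x in Ioo 0 (t / c), H x ≤ ∫⁻ x in Ioo 0 t, H x :=
    lintegral_mono_set (Ioo_subset_Ioo_right (div_le_self ht.le hc))
  rw [h1, h2] at h3
  have ht' : ENNReal.ofReal t ≠ 0 := by simpa using ht
  rw [← ENNReal.mul_le_mul_iff_right ht' ENNReal.ofReal_ne_top]
  calc ENNReal.ofReal t * avg H (t / c)
      = ENNReal.ofReal c * (ENNReal.ofReal (t / c) * avg H (t / c)) := by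
        rw [← mul_assoc, ← ENNReal.ofReal_mul hc0.le]
        congr 3
        field_simp
    _ ≤ ENNReal.ofReal c * (ENNReal.ofReal t * avg H t) := by gcongr
    _ = _ := by ring

theorem avg_tsum {H : ℕ → ℝ → ℝ≥0∞} (hH : ∀ j, Measurable (H j)) {c : ℕ → ℝ≥0∞} (t : ℝ) :
    avg (fun x => ∑' j, c j * H j x) t = ∑' j, c j * avg (H j) t := by
  unfold avg
  have hm : ∀ j, Measurable fun u => H j (t * u) := fun j => (hH j).comp (by fun_prop)
  rw [lintegral_tsum fun j => ((hm j).const_mul _).aemeasurable]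
  exact tsum_congr fun j => lintegral_const_mul _ (hm j)

/-- The Hardy-Littlewood inequality for the average over `(0, t)`. -/
theorem avg_le_avg_decr {F : ℝ → ℝ≥0∞} (hF : AEMeasurable F halfLine) {t : ℝ} (ht : 0 < t) :
    avg F t ≤ avg (decr F) t := by
  have ht' : ENNReal.ofReal t ≠ 0 := by simpa using ht
  rw [← ENNReal.mul_le_mul_iff_right ht' ENNReal.ofReal_ne_top, ← setLIntegral_Ioo_eq_avg _ ht,
    ← setLIntegral_Ioo_eq_avg _ ht]
  rw [← one_mul (∫⁻ x in Ioo 0 t, decr F x)]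
  have hsub : Ioo 0 t ⊆ Ioi 0 := fun x hx => hx.1
  refine lintegral_le_of_superlevel_le (hF.mono_measure (Measure.restrict_mono hsub le_rfl))
    (decr_antitone F).measurable.aemeasurable ENNReal.one_ne_top fun s => ?_
  rw [one_mul]
  have h1 : {x | s < decr F x} = {x | ENNReal.ofReal x < halfLine {x | s < F x}} := by
    ext x
    exact lt_decr_iff
  have h2 : ∀ x, 0 < x → (ENNReal.ofReal x < min (halfLine {x | s < F x}) (ENNReal.ofReal t) ↔
      x ∈ {x | ENNReal.ofReal x < halfLine {x | s < F x}} ∩ Ioo 0 t) := by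
    intro x hx
    rw [lt_min_iff, ENNReal.ofReal_lt_ofReal_iff ht]
    simp [hx]
  have h3 : (volume.restrict (Ioo 0 t)) {x | ENNReal.ofReal x < halfLine {x | s < F x}} =
      min (halfLine {x | s < F x}) (ENNReal.ofReal t) := by
    rw [← halfLine_ofReal_lt (min _ _), Measure.restrict_apply' measurableSet_Ioo,
      halfLine_apply {x | ENNReal.ofReal x < min _ _}]
    congr 1
    ext x
    constructor
    · intro hx
      exact ⟨(h2 x hx.2.1).2 hx, hx.2.1⟩
    · rintro ⟨hx, hx0⟩
      exact (h2 x hx0).1 hx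
  rw [h1, h3]
  refine le_min ?_ ?_
  · exact Measure.restrict_mono hsub le_rfl _
  · refine (measure_mono (subset_univ _)).trans ?_
    simp

/-- The integral of `H` over `[0, ∞)` with respect to `dφ`. -/
def cost (φ : QuasiConcave) (H : ℝ → ℝ≥0∞) : ℝ≥0∞ := ∫⁻ t in Ici (0 : ℝ), H t ∂φ.stieltjes

instance (φ : QuasiConcave) : SFinite φ.stieltjes := by
  unfold QuasiConcave.stieltjes
  infer_instance

theorem QuasiConcave.continuousAt_ext (φ : QuasiConcave) {a : ℝ} (ha : 0 < a) :
    ContinuousAt φ.ext a := by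
  have hea : φ.ext a = φ.toFun a := if_pos ha
  have h1 : Tendsto (fun t => min (φ.toFun a) (φ.toFun a * t / a)) (𝓝 a) (𝓝 (φ.ext a)) := by
    have : Continuous fun t => min (φ.toFun a) (φ.toFun a * t / a) := by fun_prop
    have h := this.tendsto a
    rw [mul_div_cancel_right₀ _ ha.ne', min_self] at h
    rwa [hea]
  have h2 : Tendsto (fun t => max (φ.toFun a) (φ.toFun a * t / a)) (𝓝 a) (𝓝 (φ.ext a)) := by
    have : Continuous fun t => max (φ.toFun a) (φ.toFun a * t / a) := by fun_prop
    have h := this.tendsto a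
    rw [mul_div_cancel_right₀ _ ha.ne', max_self] at h
    rwa [hea]
  refine tendsto_of_tendsto_of_tendsto_of_le_of_le' h1 h2 ?_ ?_
  all_goals
    filter_upwards [lt_mem_nhds ha] with t ht
    rw [QuasiConcave.ext, if_pos ht]
    rcases le_total a t with hat | hat
    · have := φ.div_anti a t ha hat
      have h3 := φ.mono a t ha hat
      rw [div_le_iff₀ ht] at this
      have : φ.toFun t ≤ φ.toFun a * t / a := by rwa [mul_div_right_comm]
      simp [h3, this]
    · have := φ.div_anti t a ht hat
      have h3 := φ.mono t a ht hat
      rw [le_div_iff₀ ht] at this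
      have : φ.toFun a * t / a ≤ φ.toFun t := by rwa [mul_div_right_comm]
      simp [h3, this]

theorem QuasiConcave.stieltjes_Ico (φ : QuasiConcave) {a : ℝ} (ha : 0 < a) :
    φ.stieltjes (Ico 0 a) = ENNReal.ofReal (φ.toFun a) := by
  have h1 : ∀ x, 0 < x → φ.ext_mono.stieltjesFunction x = φ.ext x := fun x hx => by
    rw [Monotone.stieltjesFunction_eq]
    exact rightLim_eq_of_tendsto
      ((φ.continuousAt_ext hx).tendsto.mono_left nhdsWithin_le_nhds)
  have h2 : ∀ x, x < 0 → φ.ext_mono.stieltjesFunction x = 0 := fun x hx => by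
    rw [Monotone.stieltjesFunction_eq]
    refine rightLim_eq_of_tendsto ?_
    refine Tendsto.congr' (f₁ := fun _ => (0 : ℝ)) ?_ tendsto_const_nhds
    filter_upwards [mem_nhdsWithin_of_mem_nhds (gt_mem_nhds hx)] with y hy
    exact (if_neg (not_lt.2 hy.le)).symm
  have h3 : Function.leftLim φ.ext_mono.stieltjesFunction a = φ.toFun a := by
    refine leftLim_eq_of_tendsto ?_
    have h := (φ.continuousAt_ext ha).tendsto.mono_left (nhdsWithin_le_nhds (s := Iio a))
    rw [QuasiConcave.ext, if_pos ha] at h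
    refine h.congr' ?_
    filter_upwards [mem_nhdsWithin_of_mem_nhds (lt_mem_nhds ha)] with y hy
    exact (h1 y hy).symm
  have h4 : Function.leftLim φ.ext_mono.stieltjesFunction 0 = 0 := by
    refine leftLim_eq_of_tendsto ?_
    refine Tendsto.congr' (f₁ := fun _ => (0 : ℝ)) ?_ tendsto_const_nhds
    filter_upwards [self_mem_nhdsWithin] with y hy
    exact (h2 y hy).symm
  rw [QuasiConcave.stieltjes, StieltjesFunction.measure_Ico, h3, h4, sub_zero]

theorem cost_tsum (φ : QuasiConcave) {H : ℕ → ℝ → ℝ≥0∞} (hH : ∀ j, Measurable (H j))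
    (c : ℕ → ℝ≥0∞) : cost φ (fun x => ∑' j, c j * H j x) = ∑' j, c j * cost φ (H j) := by
  unfold cost
  rw [lintegral_tsum fun j => ((hH j).const_mul _).aemeasurable]
  exact tsum_congr fun j => lintegral_const_mul _ (hH j)

theorem avg_le_cost (φ : QuasiConcave) {H : ℝ → ℝ≥0∞} (hH : Antitone H) {t : ℝ} (ht : 0 < t) :
    avg H t ≤ (ENNReal.ofReal (φ.toFun t))⁻¹ * cost φ H := by
  have hφ : ENNReal.ofReal (φ.toFun t) ≠ 0 := by simpa using φ.pos t ht
  refine lintegral_le_of_superlevel_le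
    (hH.measurable.comp (measurable_const_mul t)).aemeasurable hH.measurable.aemeasurable
    (ENNReal.inv_ne_top.2 hφ) fun s => ?_
  set M := (ENNReal.ofReal (φ.toFun t))⁻¹ * (φ.stieltjes.restrict (Ici 0)) {x | s < H x} with hM
  have key : ∀ u ∈ Ioo (0 : ℝ) 1, s < H (t * u) → ENNReal.ofReal u ≤ M := by
    intro u hu hs
    have htu : 0 < t * u := mul_pos ht hu.1
    have h1 : ENNReal.ofReal (φ.toFun (t * u)) ≤ (φ.stieltjes.restrict (Ici 0)) {x | s < H x} := by
      rw [← φ.stieltjes_Ico htu, Measure.restrict_apply' measurableSet_Ici]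
      exact measure_mono fun x hx => ⟨hs.trans_le (hH hx.2.le), hx.1⟩
    have h2 : u * φ.toFun t ≤ φ.toFun (t * u) := by
      have := φ.div_anti (t * u) t htu (by nlinarith [hu.2])
      rw [div_le_div_iff₀ ht htu] at this
      nlinarith
    rw [hM, mul_comm, ← div_eq_mul_inv, ENNReal.le_div_iff_mul_le (Or.inl hφ)
      (Or.inl ENNReal.ofReal_ne_top), ← ENNReal.ofReal_mul hu.1.le]
    exact (ENNReal.ofReal_le_ofReal h2).trans h1
  rcases eq_or_ne M ∞ with h | h
  · rw [h]; exact le_top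
  rw [Measure.restrict_apply' measurableSet_Ioo]
  have : {x | s < H (t * x)} ∩ Ioo 0 1 ⊆ Ioc 0 M.toReal := fun u hu =>
    ⟨hu.2.1, (ENNReal.ofReal_le_iff_le_toReal h).1 (key u hu.2 hu.1)⟩
  refine (measure_mono this).trans ?_
  rw [Real.volume_Ioc, sub_zero, ENNReal.ofReal_toReal h]

theorem lorentzNorm_le_of_le {φ ψ : QuasiConcave} {C : ℝ≥0}
    (h : ∀ t, 0 < t → φ.toFun t ≤ C * ψ.toFun t) (f : ℝ → ℝ) :
    lorentzNorm φ f ≤ C * lorentzNorm ψ f := by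
  have hIco : ∀ a : ℝ, φ.stieltjes (Ico 0 a) ≤ C * ψ.stieltjes (Ico 0 a) := by
    intro a
    rcases le_or_gt a 0 with ha | ha
    · simp [Ico_eq_empty (not_lt.2 ha)]
    · rw [φ.stieltjes_Ico ha, ψ.stieltjes_Ico ha, ← ENNReal.ofReal_coe_nnreal,
        ← ENNReal.ofReal_mul C.coe_nonneg]
      exact ENNReal.ofReal_le_ofReal (h a ha)
  have hm := (decr_antitone fun x => ‖f x‖ₑ).measurable
  refine lintegral_le_of_superlevel_le hm.aemeasurable hm.aemeasurable ENNReal.coe_ne_top fun s => ?_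
  have h1 : {x | s < rearr f x} = {x | ENNReal.ofReal x < halfLine {x | s < ‖f x‖ₑ}} := by
    ext x
    exact lt_decr_iff
  change (φ.stieltjes.restrict (Ici 0)) {x | s < rearr f x} ≤
    C * (ψ.stieltjes.restrict (Ici 0)) {x | s < rearr f x}
  rw [h1, Measure.restrict_apply' measurableSet_Ici, Measure.restrict_apply' measurableSet_Ici]
  generalize halfLine {x | s < ‖f x‖ₑ} = a
  induction a with
  | top =>
    have h2 : {x : ℝ | ENNReal.ofReal x < ∞} ∩ Ici 0 = ⋃ n : ℕ, Ico (0 : ℝ) n := by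
      ext x
      simp only [ENNReal.ofReal_lt_top, ofPred_true, univ_inter, mem_Ici, mem_iUnion, mem_Ico]
      exact ⟨fun hx => (exists_nat_gt x).imp fun n hn => ⟨hx, hn⟩, fun ⟨n, hn⟩ => hn.1⟩
    have hmono : Monotone fun n : ℕ => Ico (0 : ℝ) n := fun m n hmn =>
      Ico_subset_Ico_right (Nat.cast_le.2 hmn)
    rw [h2, hmono.measure_iUnion, hmono.measure_iUnion, ENNReal.mul_iSup]
    exact iSup_mono fun n => hIco n
  | coe a =>
    have h2 : {x : ℝ | ENNReal.ofReal x < a} ∩ Ici 0 = Ico 0 (a : ℝ) := by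
      ext x
      simp only [mem_inter_iff, mem_ofPred_eq, mem_Ici, mem_Ico]
      rw [and_comm]
      refine and_congr_right fun hx => ?_
      rw [ENNReal.ofReal_lt_iff_lt_toReal hx ENNReal.coe_ne_top]
      rfl
    rw [h2]
    exact hIco _

/-- The least cost of a decreasing function `H` whose averages dominate the rearrangement of `F`. -/
def optNorm (φ : QuasiConcave) (F : ℝ → ℝ≥0∞) : ℝ≥0∞ :=
  ⨅ (H : ℝ → ℝ≥0∞) (_ : Antitone H) (_ : ∀ t, 0 < t → decr F t ≤ avg H t), cost φ H

theorem optNorm_le {φ : QuasiConcave} {F H : ℝ → ℝ≥0∞} (hH : Antitone H)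
    (h : ∀ t, 0 < t → decr F t ≤ avg H t) : optNorm φ F ≤ cost φ H :=
  iInf_le_of_le H (iInf_le_of_le hH (iInf_le _ h))

theorem le_optNorm {φ : QuasiConcave} {F : ℝ → ℝ≥0∞} {a : ℝ≥0∞}
    (h : ∀ H : ℝ → ℝ≥0∞, Antitone H → (∀ t, 0 < t → decr F t ≤ avg H t) → a ≤ cost φ H) :
    a ≤ optNorm φ F :=
  le_iInf fun H => le_iInf fun hH => le_iInf fun hF => h H hH hF

theorem exists_cost_lt {φ : QuasiConcave} {F : ℝ → ℝ≥0∞} {a : ℝ≥0∞} (h : optNorm φ F < a) :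
    ∃ H : ℝ → ℝ≥0∞, Antitone H ∧ (∀ t, 0 < t → decr F t ≤ avg H t) ∧ cost φ H < a := by
  by_contra! h'
  exact (le_optNorm h').not_gt h

theorem optNorm_mono_decr {φ : QuasiConcave} {F G : ℝ → ℝ≥0∞}
    (h : ∀ t, 0 < t → decr F t ≤ decr G t) : optNorm φ F ≤ optNorm φ G :=
  le_optNorm fun _ hH hG => optNorm_le hH fun t ht => (h t ht).trans (hG t ht)

theorem optNorm_mono_ae {φ : QuasiConcave} {F G : ℝ → ℝ≥0∞} (h : F ≤ᵐ[halfLine] G) :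
    optNorm φ F ≤ optNorm φ G := optNorm_mono_decr fun t _ => decr_mono_ae h t

theorem decr_le_optNorm (φ : QuasiConcave) (F : ℝ → ℝ≥0∞) {t : ℝ} (ht : 0 < t) :
    decr F t ≤ (ENNReal.ofReal (φ.toFun t))⁻¹ * optNorm φ F := by
  have hφ : ENNReal.ofReal (φ.toFun t) ≠ 0 := by simpa using φ.pos t ht
  rw [mul_comm, ← div_eq_mul_inv,
    ENNReal.le_div_iff_mul_le (Or.inl hφ) (Or.inl ENNReal.ofReal_ne_top)]
  refine le_optNorm fun H hH hF => ?_
  rw [← ENNReal.le_div_iff_mul_le (Or.inl hφ) (Or.inl ENNReal.ofReal_ne_top), div_eq_mul_inv,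
    mul_comm]
  exact (hF t ht).trans (avg_le_cost φ hH ht)

theorem ae_lt_top_of_optNorm_lt_top {φ : QuasiConcave} {F : ℝ → ℝ≥0∞} (h : optNorm φ F < ∞) :
    ∀ᵐ x ∂halfLine, F x < ∞ := by
  refine ae_lt_top_of_decr_lt_top fun t ht => (decr_le_optNorm φ F ht).trans_lt ?_
  have hφ : ENNReal.ofReal (φ.toFun t) ≠ 0 := by simpa using φ.pos t ht
  exact ENNReal.mul_lt_top (ENNReal.inv_ne_top.2 hφ).lt_top h

theorem optNorm_eq_zero_iff {φ : QuasiConcave} {F : ℝ → ℝ≥0∞} :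
    optNorm φ F = 0 ↔ ∀ᵐ x ∂halfLine, F x = 0 := by
  constructor
  · intro h
    refine ae_eq_zero_of_decr_eq_zero fun t ht => ?_
    simpa [h] using decr_le_optNorm φ F ht
  · intro h
    refine le_antisymm ?_ zero_le
    have h1 : optNorm φ F ≤ cost φ fun _ => 0 := by
      refine optNorm_le antitone_const fun t _ => ?_
      refine (decr_mono_ae (G := fun _ => 0) (h.mono fun x hx => hx.le) t).trans ?_
      exact (decr_le_of_le (Q := fun _ => 0) fun _ _ _ => le_rfl).trans zero_le
    simpa [cost] using h1

theorem optNorm_smul_le (φ : QuasiConcave) (F : ℝ → ℝ≥0∞) {c : ℝ≥0∞} (hc0 : c ≠ 0) (hc : c ≠ ∞) :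
    optNorm φ (fun x => c * F x) ≤ c * optNorm φ F := by
  rw [mul_comm, ← ENNReal.div_le_iff_le_mul (Or.inl hc0) (Or.inl hc)]
  refine le_optNorm fun H hH hF => ?_
  rw [ENNReal.div_le_iff_le_mul (Or.inl hc0) (Or.inl hc), mul_comm]
  have h1 : avg (fun x => c * H x) = fun t => c * avg H t :=
    funext fun t => lintegral_const_mul' _ _ hc
  have h2 : cost φ (fun x => c * H x) = c * cost φ H := lintegral_const_mul' _ _ hc
  rw [← h2]
  refine optNorm_le (fun x y hxy => mul_le_mul_right (hH hxy) c) fun t ht => ?_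
  rw [h1]
  exact (decr_smul_le c t).trans (mul_le_mul_right (hF t ht) c)

theorem optNorm_smul (φ : QuasiConcave) (F : ℝ → ℝ≥0∞) {c : ℝ≥0∞} (hc : c ≠ ∞) :
    optNorm φ (fun x => c * F x) = c * optNorm φ F := by
  rcases eq_or_ne c 0 with rfl | hc0
  · simp [optNorm_eq_zero_iff]
  refine le_antisymm (optNorm_smul_le φ F hc0 hc) ?_
  have h := optNorm_smul_le φ (fun x => c * F x) (ENNReal.inv_ne_zero.2 hc) (ENNReal.inv_ne_top.2 hc0)
  simp_rw [← mul_assoc, ENNReal.inv_mul_cancel hc0 hc, one_mul] at h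
  calc c * optNorm φ F ≤ c * (c⁻¹ * optNorm φ fun x => c * F x) := mul_le_mul_right h c
    _ = _ := by rw [← mul_assoc, ENNReal.mul_inv_cancel hc0 hc, one_mul]

theorem optNorm_tsum_le (φ : QuasiConcave) (F : ℕ → ℝ → ℝ≥0∞) :
    optNorm φ (fun x => ∑' j, F j x) ≤ ∑' j, ENNReal.ofReal (2 * 2 ^ j) * optNorm φ (F j) := by
  have hw0 : ∀ j : ℕ, ENNReal.ofReal (2 * 2 ^ j) ≠ 0 := fun j => by
    rw [Ne, ENNReal.ofReal_eq_zero, not_le]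
    positivity
  by_cases hfin : ∀ j, optNorm φ (F j) ≠ ∞
  · refine ENNReal.le_of_forall_pos_le_add fun ε hε _ => ?_
    obtain ⟨δ, hδ, hsum⟩ := ENNReal.exists_pos_sum_of_countable'
      (ENNReal.coe_ne_zero.2 hε.ne') ℕ
    have hex : ∀ j, ∃ H : ℝ → ℝ≥0∞, Antitone H ∧ (∀ t, 0 < t → decr (F j) t ≤ avg H t) ∧
        cost φ H < optNorm φ (F j) + δ j / ENNReal.ofReal (2 * 2 ^ j) := fun j =>
      exists_cost_lt (ENNReal.lt_add_right (hfin j)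
        (ENNReal.div_pos (hδ j).ne' ENNReal.ofReal_ne_top).ne')
    choose H hH hFH hcost using hex
    have h1 : optNorm φ (fun x => ∑' j, F j x) ≤
        cost φ fun x => ∑' j, ENNReal.ofReal (2 * 2 ^ j) * H j x := by
      refine optNorm_le (fun x y hxy =>
        ENNReal.tsum_le_tsum fun j => mul_le_mul_right (hH j hxy) _) fun t ht => ?_
      rw [avg_tsum fun j => (hH j).measurable]
      refine (decr_tsum_le F ht.le).trans (ENNReal.tsum_le_tsum fun j => ?_)
      rw [div_div]
      refine (hFH j _ (by positivity)).trans (avg_div_le _ ht ?_)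
      have : (1 : ℝ) ≤ 2 ^ j := one_le_pow₀ one_le_two
      linarith
    refine h1.trans ?_
    rw [cost_tsum φ fun j => (hH j).measurable]
    calc ∑' j, ENNReal.ofReal (2 * 2 ^ j) * cost φ (H j)
        ≤ ∑' j, (ENNReal.ofReal (2 * 2 ^ j) * optNorm φ (F j) + δ j) := by
          refine ENNReal.tsum_le_tsum fun j => ?_
          refine (mul_le_mul_right (hcost j).le _).trans ?_
          rw [mul_add, ENNReal.mul_div_cancel (hw0 j) ENNReal.ofReal_ne_top]
      _ ≤ _ := by
          rw [ENNReal.tsum_add]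
          gcongr
  · push Not at hfin
    obtain ⟨j, hj⟩ := hfin
    refine le_top.trans ?_
    refine le_trans ?_ (ENNReal.le_tsum j)
    rw [hj, ENNReal.mul_top (hw0 j)]

theorem optNorm_add_le (φ : QuasiConcave) (F G : ℝ → ℝ≥0∞) :
    optNorm φ (fun x => F x + G x) ≤ 4 * (optNorm φ F + optNorm φ G) := by
  have h0 : optNorm φ (fun _ => 0) = 0 := optNorm_eq_zero_iff.2 (Eventually.of_forall fun _ => rfl)
  let U : ℕ → ℝ → ℝ≥0∞ := fun j => if j = 0 then F else if j = 1 then G else fun _ => 0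
  have hU : ∀ j, j ∉ Finset.range 2 → U j = fun _ => 0 := fun j hj => by
    rw [Finset.mem_range, not_lt] at hj
    simp [U, show j ≠ 0 by omega, show j ≠ 1 by omega]
  have h := optNorm_tsum_le φ U
  have h1 : (fun x => ∑' j, U j x) = fun x => F x + G x := by
    ext x
    rw [tsum_eq_sum (s := Finset.range 2) fun j hj => by rw [hU j hj]]
    simp [Finset.sum_range_succ, U]
  rw [h1, tsum_eq_sum (s := Finset.range 2) fun j hj => by rw [hU j hj, h0, mul_zero]] at h
  refine h.trans ?_
  simp only [Finset.sum_range_succ, Finset.sum_range_zero, U]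
  norm_num
  rw [mul_add]
  gcongr
  norm_num

theorem avg_indicator_Iio (a x : ℝ) (hx : 0 < x) :
    avg ((Iio a).indicator fun _ => 1) x = ENNReal.ofReal (min 1 (a / x)) := by
  have : (fun u => (Iio a).indicator (fun _ => (1 : ℝ≥0∞)) (x * u)) =
      (Iio (a / x)).indicator fun _ => 1 := by
    ext u
    have : x * u ∈ Iio a ↔ u ∈ Iio (a / x) := by rw [mem_Iio, mem_Iio, lt_div_iff₀' hx]
    simp only [indicator, this]
  rw [avg, this, lintegral_indicator measurableSet_Iio, lintegral_one,
    Measure.restrict_apply_univ, Measure.restrict_apply measurableSet_Iio, inter_comm,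
    Ioo_inter_Iio, Real.volume_Ioo, sub_zero]

theorem antitone_indicator_Iio (a : ℝ) : Antitone ((Iio a).indicator fun _ => (1 : ℝ≥0∞)) := by
  intro x y hxy
  by_cases hy : y < a
  · simp [indicator, hy, hxy.trans_lt hy]
  · simp [indicator, hy]

theorem cost_indicator_Iio (φ : QuasiConcave) {a : ℝ} (ha : 0 < a) :
    cost φ ((Iio a).indicator fun _ => 1) = ENNReal.ofReal (φ.toFun a) := by
  rw [cost, lintegral_indicator measurableSet_Iio, lintegral_one,
    Measure.restrict_apply_univ, Measure.restrict_apply measurableSet_Iio, inter_comm,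
    Ici_inter_Iio, φ.stieltjes_Ico ha]

theorem optNorm_le_of_le_min (φ : QuasiConcave) {F : ℝ → ℝ≥0∞} {a : ℝ} (ha : 0 < a)
    (h : ∀ x, 0 < x → decr F x ≤ ENNReal.ofReal (min 1 (a / x))) :
    optNorm φ F ≤ ENNReal.ofReal (φ.toFun a) := by
  rw [← cost_indicator_Iio φ ha]
  refine optNorm_le (antitone_indicator_Iio a) fun t ht => ?_
  rw [avg_indicator_Iio _ _ ht]
  exact h t ht

theorem optNorm_indicator_lt_top (φ : QuasiConcave) {E : Set ℝ} (hE : halfLine E < ∞) :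
    optNorm φ (fun x => ‖E.indicator (fun _ => (1 : ℝ)) x‖ₑ) < ∞ := by
  set a := (halfLine E).toReal + 1 with ha
  have ha0 : 0 < a := by positivity
  refine (optNorm_le_of_le_min φ ha0 fun x hx => ?_).trans_lt ENNReal.ofReal_lt_top
  rcases le_or_gt x a with hxa | hxa
  · rw [min_eq_left ((one_le_div hx).2 hxa), ENNReal.ofReal_one]
    refine decr_le_iff.2 ?_
    have : {y | 1 < ‖E.indicator (fun _ => (1 : ℝ)) y‖ₑ} = ∅ := by
      ext y
      by_cases hy : y ∈ E <;> simp [hy]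
    rw [this, measure_empty]
    exact zero_le
  · refine le_trans (decr_le_iff.2 ?_) zero_le
    have : {y | 0 < ‖E.indicator (fun _ => (1 : ℝ)) y‖ₑ} = E := by
      ext y
      by_cases hy : y ∈ E <;> simp [hy]
    rw [this, ← ENNReal.ofReal_toReal hE.ne]
    exact ENNReal.ofReal_le_ofReal (by linarith)

theorem optNorm_dilG_le (φ : QuasiConcave) {t : ℝ} (ht : 0 < t) :
    optNorm φ (fun x => ‖dilG t x‖ₑ) ≤ ENNReal.ofReal (φ.toFun t) := by
  refine optNorm_le_of_le_min φ ht fun x hx => ?_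
  refine decr_le_of_le (Q := fun x => ENNReal.ofReal (min 1 (t / x))) fun y hy hxy => ?_
  have hpos : 0 < dilG t y := by unfold dilG; positivity
  rw [Real.enorm_of_nonneg hpos.le]
  refine ENNReal.ofReal_le_ofReal (le_min ?_ ?_)
  · exact (div_le_one (by positivity)).2 (by linarith [div_pos hy ht])
  · calc dilG t y = t / (t + y) := by unfold dilG; field_simp
      _ ≤ t / x := by gcongr; linarith

theorem le_optNorm_dilG (φ : QuasiConcave) {t : ℝ} (ht : 0 < t) :
    ENNReal.ofReal (φ.toFun t) ≤ 3 * optNorm φ (fun x => ‖dilG t x‖ₑ) := by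
  have hφ : ENNReal.ofReal (φ.toFun t) ≠ 0 := by simpa using φ.pos t ht
  have h1 : (3 : ℝ≥0∞)⁻¹ ≤ decr (fun x => ‖dilG t x‖ₑ) t := by
    refine le_decr_of_le ht.le (r := 2 * t) (by linarith) fun x hx => ?_
    have hx0 := hx.1
    have hpos : 0 < dilG t x := by unfold dilG; positivity
    rw [Real.enorm_of_nonneg hpos.le]
    have h3 : (3 : ℝ≥0∞)⁻¹ = ENNReal.ofReal (1 / 3) := by
      rw [one_div, ENNReal.ofReal_inv_of_pos (by norm_num)]
      norm_num
    rw [h3]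
    refine ENNReal.ofReal_le_ofReal ?_
    unfold dilG
    have : x / t ≤ 2 := (div_le_iff₀ ht).2 hx.2.le
    refine one_div_le_one_div_of_le (by positivity) (by linarith)
  have h2 := h1.trans (decr_le_optNorm φ _ ht)
  rw [mul_comm, ← div_eq_mul_inv, ENNReal.le_div_iff_mul_le (Or.inl hφ)
    (Or.inl ENNReal.ofReal_ne_top), mul_comm, ← div_eq_mul_inv,
    ENNReal.div_le_iff_le_mul (Or.inl (by norm_num)) (Or.inl (by norm_num))] at h2
  rwa [mul_comm]

theorem setOf_coe_lt_enorm (u : ℝ → ℝ) (s : ℝ≥0) :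
    {x | (s : ℝ≥0∞) < ‖u x‖ₑ} = {x | (s : ℝ) < |u x|} := by
  ext x
  simp only [mem_ofPred_eq, ← ofReal_norm, Real.norm_eq_abs]
  rw [ENNReal.lt_ofReal_iff_toReal_lt ENNReal.coe_ne_top]
  rfl

theorem decr_eq_of_equimeasurable {f g : ℝ → ℝ} (h : Equimeasurable f g) {t : ℝ} :
    decr (fun x => ‖f x‖ₑ) t = decr (fun x => ‖g x‖ₑ) t := by
  unfold decr
  congr 1
  ext s
  induction s with
  | top => simp
  | coe s => rw [mem_ofPred_eq, mem_ofPred_eq, setOf_coe_lt_enorm, setOf_coe_lt_enorm, h s]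

theorem optNorm_enorm_add_le (φ : QuasiConcave) (f g : ℝ → ℝ) :
    optNorm φ (fun x => ‖f x + g x‖ₑ) ≤
      4 * (optNorm φ (fun x => ‖f x‖ₑ) + optNorm φ (fun x => ‖g x‖ₑ)) :=
  (optNorm_mono_ae (Eventually.of_forall fun _ => enorm_add_le _ _)).trans (optNorm_add_le φ _ _)

theorem tsum_two_pow_mul_inv_four_pow (k : ℕ) :
    ∑' j : ℕ, ENNReal.ofReal (2 * 2 ^ j) * (4 : ℝ≥0∞)⁻¹ ^ (k + j) = 4 * 4⁻¹ ^ k := by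
  have h : ∀ j : ℕ, ENNReal.ofReal (2 * 2 ^ j) * (4 : ℝ≥0∞)⁻¹ ^ (k + j) =
      2 * 4⁻¹ ^ k * 2⁻¹ ^ j := by
    intro j
    have h2 : (4 : ℝ≥0∞)⁻¹ = 2⁻¹ * 2⁻¹ := by
      rw [← ENNReal.mul_inv (by simp) (by simp)]
      norm_num
    have h3 : (2 : ℝ≥0∞) ^ j * 2⁻¹ ^ j = 1 := by
      rw [← mul_pow, ENNReal.mul_inv_cancel (by simp) (by simp), one_pow]
    rw [ENNReal.ofReal_mul (by norm_num), ENNReal.ofReal_pow (by norm_num), ENNReal.ofReal_ofNat,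
      pow_add, h2, mul_pow _ _ j]
    calc _ = 2 * (2⁻¹ * 2⁻¹) ^ k * 2⁻¹ ^ j * ((2 : ℝ≥0∞) ^ j * 2⁻¹ ^ j) := by ring
      _ = _ := by rw [h3, mul_one]
  simp_rw [h]
  rw [ENNReal.tsum_mul_left, ENNReal.tsum_geometric, ENNReal.one_sub_inv_two, inv_inv]
  ring

/-- A sequence whose successive differences are small converges in the optimal norm. -/
theorem exists_limit_of_optNorm_sub_le (φ : QuasiConcave) {v : ℕ → ℝ → ℝ}
    (hv : ∀ n, AEMeasurable (v n) halfLine)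
    (h : ∀ k, optNorm φ (fun x => ‖v (k + 1) x - v k x‖ₑ) ≤ 4⁻¹ ^ k) :
    ∃ f : ℝ → ℝ, AEMeasurable f halfLine ∧
      ∀ k, optNorm φ (fun x => ‖v k x - f x‖ₑ) ≤ 4 * 4⁻¹ ^ k := by
  have htail : ∀ k, optNorm φ (fun x => ∑' j, ‖v (k + j + 1) x - v (k + j) x‖ₑ) ≤ 4 * 4⁻¹ ^ k :=
    fun k => (optNorm_tsum_le φ fun j x => ‖v (k + j + 1) x - v (k + j) x‖ₑ).trans <| by
      rw [← tsum_two_pow_mul_inv_four_pow]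
      exact ENNReal.tsum_le_tsum fun j => mul_le_mul_right (h _) _
  have hd : ∀ x n, edist (v n x) (v (n + 1) x) ≤ ‖v (n + 1) x - v n x‖ₑ := fun x n => by
    rw [edist_comm, edist_eq_enorm_sub]
  have hlim : ∀ᵐ x ∂halfLine, ∃ l, Tendsto (fun n => v n x) atTop (𝓝 l) := by
    have h0 := ae_lt_top_of_optNorm_lt_top ((htail 0).trans_lt (by simp))
    filter_upwards [h0] with x hx
    simp only [zero_add] at hx
    exact cauchySeq_tendsto_of_complete
      (cauchySeq_of_edist_le_of_tsum_ne_top _ (hd x) hx.ne)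
  obtain ⟨f, hf, hvf⟩ := measurable_limit_of_tendsto_metrizable_ae hv hlim
  refine ⟨f, hf.aemeasurable, fun k => (optNorm_mono_ae ?_).trans (htail k)⟩
  filter_upwards [hvf] with x hx
  rw [← edist_eq_enorm_sub]
  exact edist_le_tsum_of_edist_le_of_tendsto _ (hd x) hx k

theorem exists_limit_of_cauchy (φ : QuasiConcave) {u : ℕ → ℝ → ℝ}
    (hu : ∀ n, AEMeasurable (u n) halfLine)
    (h : ∀ ε : ℝ≥0∞, 0 < ε → ∃ N, ∀ m ≥ N, ∀ n ≥ N, optNorm φ (fun x => ‖u m x - u n x‖ₑ) < ε) :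
    ∃ f : ℝ → ℝ, AEMeasurable f halfLine ∧
      Tendsto (fun n => optNorm φ fun x => ‖u n x - f x‖ₑ) atTop (𝓝 0) := by
  choose N hN using fun k : ℕ => h (4⁻¹ ^ k) (ENNReal.pow_pos (by simp) k)
  let n : ℕ → ℕ := fun k => ∑ i ∈ Finset.range (k + 1), N i
  have hle : ∀ k, N k ≤ n k := fun k =>
    Finset.single_le_sum (f := N) (fun _ _ => Nat.zero_le _) (Finset.self_mem_range_succ k)
  have hsucc : ∀ k, n k ≤ n (k + 1) := fun k => by
    simp only [n, Finset.sum_range_succ _ (k + 1)]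
    omega
  obtain ⟨f, hf, hlim⟩ := exists_limit_of_optNorm_sub_le φ (v := fun k => u (n k))
    (fun k => hu _) fun k => (hN k _ ((hle k).trans (hsucc k)) _ (hle k)).le
  refine ⟨f, hf, ENNReal.tendsto_nhds_zero.2 fun ε hε => ?_⟩
  have hsmall : Tendsto (fun k : ℕ => 20 * (4 : ℝ≥0∞)⁻¹ ^ k) atTop (𝓝 0) := by
    have := ENNReal.Tendsto.const_mul (a := 20)
      (ENNReal.tendsto_pow_atTop_nhds_zero_of_lt_one (r := 4⁻¹)
        (ENNReal.inv_lt_one.2 (by norm_num))) (Or.inr (by norm_num))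
    rwa [mul_zero] at this
  obtain ⟨k, hk⟩ := (hsmall.eventually (ge_mem_nhds hε)).exists
  filter_upwards [eventually_ge_atTop (N k)] with m hm
  calc optNorm φ (fun x => ‖u m x - f x‖ₑ)
      = optNorm φ (fun x => ‖(u m x - u (n k) x) + (u (n k) x - f x)‖ₑ) := by simp
    _ ≤ _ := optNorm_enorm_add_le φ (fun x => u m x - u (n k) x) fun x => u (n k) x - f x
    _ ≤ 4 * (4⁻¹ ^ k + 4 * 4⁻¹ ^ k) := by
        gcongr
        · exact (hN k m hm _ (hle k)).le
        · exact hlim k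
    _ = 20 * 4⁻¹ ^ k := by ring
    _ ≤ ε := hk

/-- The space of functions whose rearrangement is dominated by the Hardy averages of a decreasing
function of finite cost. -/
def optRange (φ : QuasiConcave) : RIQuasiBanach where
  nrm f := optNorm φ fun x => ‖f x‖ₑ
  nrm_eq_zero f _ := by
    rw [optNorm_eq_zero_iff]
    simp only [enorm_eq_zero]
    rfl
  nrm_smul c f _ := by
    simp only [enorm_mul]
    exact optNorm_smul φ _ enorm_ne_top
  quasi_triangle := ⟨4, fun f g _ _ => optNorm_enorm_add_le φ f g⟩
  mono f g _ _ h := optNorm_mono_ae <| h.mono fun x hx => by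
    simpa only [← ofReal_norm, Real.norm_eq_abs] using ENNReal.ofReal_le_ofReal hx
  rearrangement_invariant f g _ _ h :=
    le_antisymm (optNorm_mono_decr fun _ _ => (decr_eq_of_equimeasurable h).le)
      (optNorm_mono_decr fun _ _ => (decr_eq_of_equimeasurable h).ge)
  nrm_indicator_lt_top E _ hE := optNorm_indicator_lt_top φ hE
  complete u hu h := by
    obtain ⟨f, hf, hlim⟩ := exists_limit_of_cauchy φ (fun n => (hu n).1) h
    refine ⟨f, ⟨hf, ?_⟩, hlim⟩
    obtain ⟨n, hn⟩ := (hlim.eventually (gt_mem_nhds zero_lt_one)).exists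
    have h1 := optNorm_enorm_add_le φ (u n) fun x => f x - u n x
    simp only [add_sub_cancel, ← edist_eq_enorm_sub, edist_comm (f _)] at h1
    simp only [edist_eq_enorm_sub] at h1
    refine h1.trans_lt (ENNReal.mul_lt_top (by norm_num) (ENNReal.add_lt_top.2 ⟨(hu n).2, ?_⟩))
    exact hn.trans ENNReal.one_lt_top

theorem avg_lt_top_of_cost_lt_top {φ : QuasiConcave} {H : ℝ → ℝ≥0∞} (hH : Antitone H) (h : cost φ H < ∞)
    {t : ℝ} (ht : 0 < t) : avg H t < ∞ := by
  have hφ : ENNReal.ofReal (φ.toFun t) ≠ 0 := by simpa using φ.pos t ht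
  exact (avg_le_cost φ hH ht).trans_lt (ENNReal.mul_lt_top (ENNReal.inv_ne_top.2 hφ).lt_top h)

theorem integrableOn_Ioc_of_mem_lorentzSpace {φ : QuasiConcave} {f : ℝ → ℝ} (hf : f ∈ lorentzSpace φ)
    {t : ℝ} (ht : 0 < t) : IntegrableOn f (Ioc 0 t) := by
  rw [integrableOn_Ioc_iff_integrableOn_Ioo]
  have hsub : Ioo 0 t ⊆ Ioi 0 := fun x hx => hx.1
  refine ⟨(hf.1.mono_measure (Measure.restrict_mono hsub le_rfl)).aestronglyMeasurable, ?_⟩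
  rw [HasFiniteIntegral, setLIntegral_Ioo_eq_avg _ ht]
  refine ENNReal.mul_lt_top ENNReal.ofReal_lt_top ((avg_le_avg_decr hf.1.enorm ht).trans_lt ?_)
  exact avg_lt_top_of_cost_lt_top (decr_antitone _) hf.2 ht

theorem enorm_hardy_le {f : ℝ → ℝ} (hf : AEMeasurable f halfLine) {x : ℝ} (hx : 0 < x) :
    ‖hardy f x‖ₑ ≤ avg (rearr f) x := by
  refine le_trans ?_ (avg_le_avg_decr hf.enorm hx)
  have hx' : ENNReal.ofReal x ≠ 0 := by simpa using hx
  rw [← ENNReal.mul_le_mul_iff_right hx' ENNReal.ofReal_ne_top, ← setLIntegral_Ioo_eq_avg _ hx,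
    ← Real.enorm_of_nonneg hx.le, ← enorm_mul, hardy, ← mul_assoc, mul_one_div_cancel hx.ne', one_mul,
    intervalIntegral.integral_of_le hx.le, restrict_Ioo_eq_restrict_Ioc]
  exact enorm_integral_le_lintegral_enorm _

theorem aemeasurable_hardy {φ : QuasiConcave} {f : ℝ → ℝ} (hf : f ∈ lorentzSpace φ) :
    AEMeasurable (hardy f) halfLine := by
  set g := (Ioi (0 : ℝ)).indicator f with hg
  have hint : ∀ a b, IntervalIntegrable g volume a b := by
    intro a b
    have hc : 0 < max 1 (max a b) := lt_max_of_lt_left one_pos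
    have h1 : IntegrableOn g (Iic (max 1 (max a b))) := by
      rw [hg, IntegrableOn, integrable_indicator_iff measurableSet_Ioi, IntegrableOn,
        Measure.restrict_restrict measurableSet_Ioi, Ioi_inter_Iic]
      exact integrableOn_Ioc_of_mem_lorentzSpace hf hc
    rw [intervalIntegrable_iff]
    exact h1.mono_set fun x hx => hx.2.trans (le_max_right _ _)
  have hm : Measurable fun t : ℝ => 1 / t * ∫ r in (0 : ℝ)..t, g r :=
    (measurable_const.div measurable_id).mul
      (intervalIntegral.continuous_primitive hint 0).measurable
  refine hm.aemeasurable.congr ?_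
  filter_upwards [ae_halfLine_pos] with t ht
  rw [hardy, intervalIntegral.integral_of_le ht.le, intervalIntegral.integral_of_le ht.le]
  congr 1
  exact setIntegral_congr_fun measurableSet_Ioc fun r hr => indicator_of_mem (mem_Ioi.2 hr.1) f

theorem hardyBounded_optRange (φ : QuasiConcave) : HardyBounded φ (optRange φ) := by
  refine ⟨1, fun f hf => ?_⟩
  have h : (optRange φ).nrm (hardy f) ≤ lorentzNorm φ f := by
    have hanti : Antitone (rearr f) := decr_antitone _
    refine optNorm_le hanti fun t ht => decr_le_of_le fun x hx htx => ?_
    exact (enorm_hardy_le hf.1 hx).trans (avg_antitone hanti htx)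
  exact ⟨⟨aemeasurable_hardy hf, h.trans_lt hf.2⟩, by simpa using h⟩

theorem hardy_toReal {φ : QuasiConcave} {H : ℝ → ℝ≥0∞} (hH : Antitone H) (h : cost φ H < ∞)
    {t : ℝ} (ht : 0 < t) : hardy (fun x => (H x).toReal) t = (avg H t).toReal := by
  have h1 : ∀ᵐ x ∂volume.restrict (Ioo 0 t), H x < ∞ := by
    filter_upwards [ae_restrict_mem measurableSet_Ioo] with x hx
    exact (le_avg hH hx.1).trans_lt (avg_lt_top_of_cost_lt_top hH h hx.1)
  rw [hardy, intervalIntegral.integral_of_le ht.le, ← restrict_Ioo_eq_restrict_Ioc,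
    integral_toReal hH.measurable.aemeasurable h1, setLIntegral_Ioo_eq_avg _ ht, ENNReal.toReal_mul,
    ENNReal.toReal_ofReal ht.le, ← mul_assoc, one_div_mul_cancel ht.ne', one_mul]

theorem toReal_mem_lorentzSpace {φ : QuasiConcave} {H : ℝ → ℝ≥0∞} (hH : Antitone H)
    (h : cost φ H < ∞) : (fun x => (H x).toReal) ∈ lorentzSpace φ ∧
      lorentzNorm φ (fun x => (H x).toReal) ≤ cost φ H := by
  have h1 : lorentzNorm φ (fun x => (H x).toReal) ≤ cost φ H := by
    refine setLIntegral_mono' measurableSet_Ici fun t _ => ?_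
    refine decr_le_of_le fun x _ htx => le_trans ?_ (hH htx)
    rw [Real.enorm_of_nonneg ENNReal.toReal_nonneg]
    exact ENNReal.ofReal_toReal_le
  exact ⟨⟨hH.measurable.ennreal_toReal.aemeasurable, h1.trans_lt h⟩, h1⟩

theorem equimeasurable_toReal_rearr {f : ℝ → ℝ} (h : ∀ t, 0 < t → rearr f t < ∞) :
    Equimeasurable f fun t => (rearr f t).toReal := by
  intro s
  rw [← setOf_coe_lt_enorm]
  conv_lhs => rw [← halfLine_ofReal_lt (halfLine {x | (s : ℝ≥0∞) < ‖f x‖ₑ})]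
  refine measure_congr ?_
  filter_upwards [ae_halfLine_pos] with x hx
  apply propext
  change ENNReal.ofReal x < _ ↔ (s : ℝ) < |(rearr f x).toReal|
  rw [← lt_decr_iff, abs_of_nonneg ENNReal.toReal_nonneg, ← rearr_eq_decr,
    ← ENNReal.coe_toReal s, ENNReal.toReal_lt_toReal ENNReal.coe_ne_top (h x hx).ne]

theorem optRange_embeds {φ : QuasiConcave} {Z : RIQuasiBanach} (hZ : HardyBounded φ Z) :
    Embeds (optRange φ) Z := by
  obtain ⟨C, hC⟩ := hZ
  have key : ∀ f ∈ (optRange φ).space, ∀ H : ℝ → ℝ≥0∞, Antitone H →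
      (∀ t, 0 < t → rearr f t ≤ avg H t) → cost φ H < ∞ → Z.nrm f ≤ C * cost φ H := by
    intro f hf H hH hfH hcost
    have hfin : ∀ t, 0 < t → rearr f t < ∞ := fun t ht =>
      (hfH t ht).trans_lt (avg_lt_top_of_cost_lt_top hH hcost ht)
    obtain ⟨hmem, hle⟩ := toReal_mem_lorentzSpace hH hcost
    obtain ⟨hS, hSle⟩ := hC _ hmem
    have hm : AEMeasurable (fun t => (rearr f t).toReal) halfLine :=
      (decr_antitone fun x => ‖f x‖ₑ).measurable.ennreal_toReal.aemeasurable
    rw [Z.rearrangement_invariant _ _ hf.1 hm (equimeasurable_toReal_rearr hfin)]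
    refine (Z.mono _ _ hm hS.1 ?_).trans (hSle.trans (mul_le_mul_right hle _))
    filter_upwards [ae_halfLine_pos] with t ht
    rw [hardy_toReal hH hcost ht, abs_of_nonneg ENNReal.toReal_nonneg,
      abs_of_nonneg ENNReal.toReal_nonneg]
    exact ENNReal.toReal_mono (avg_lt_top_of_cost_lt_top hH hcost ht).ne (hfH t ht)
  refine ⟨C + 1, fun f hf => ?_⟩
  have hle : Z.nrm f ≤ (C + 1 : ℝ≥0) * (optRange φ).nrm f := by
    have h0 : ((C + 1 : ℝ≥0) : ℝ≥0∞) ≠ 0 := by positivity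
    rw [mul_comm, ← ENNReal.div_le_iff_le_mul (Or.inl h0) (Or.inl ENNReal.coe_ne_top)]
    refine le_optNorm fun H hH hfH => ?_
    rw [ENNReal.div_le_iff_le_mul (Or.inl h0) (Or.inl ENNReal.coe_ne_top), mul_comm]
    rcases eq_or_ne (cost φ H) ∞ with hc | hc
    · rw [hc, ENNReal.mul_top h0]
      exact le_top
    · refine (key f hf H hH hfH hc.lt_top).trans ?_
      gcongr
      exact le_self_add
  exact ⟨⟨hf.1, hle.trans_lt (ENNReal.mul_lt_top ENNReal.coe_lt_top hf.2)⟩, hle⟩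

theorem isOptimalRange_optRange (φ : QuasiConcave) : IsOptimalRange φ (optRange φ) :=
  ⟨hardyBounded_optRange φ, fun _ hZ => optRange_embeds hZ⟩

theorem dilG_mem_optRange (φ : QuasiConcave) {t : ℝ} (ht : 0 < t) : dilG t ∈ (optRange φ).space :=
  ⟨aemeasurable_dilG t, (optNorm_dilG_le φ ht).trans_lt ENNReal.ofReal_lt_top⟩

theorem sameLorentz_of_le {φ ψ : QuasiConcave} {A B : ℝ≥0}
    (hA : ∀ t, 0 < t → φ.toFun t ≤ A * ψ.toFun t) (hB : ∀ t, 0 < t → ψ.toFun t ≤ B * φ.toFun t) :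
    SameLorentz φ ψ := by
  have h1 := lorentzNorm_le_of_le hA
  have h2 := lorentzNorm_le_of_le hB
  refine ⟨?_, max A B, fun f _ => ⟨(h1 f).trans ?_, (h2 f).trans ?_⟩⟩
  · ext f
    exact and_congr_right fun _ =>
      ⟨fun h => (h2 f).trans_lt (ENNReal.mul_lt_top ENNReal.coe_lt_top h),
        fun h => (h1 f).trans_lt (ENNReal.mul_lt_top ENNReal.coe_lt_top h)⟩
  · gcongr
    exact le_max_left A B
  · gcongr
    exact le_max_right A B

theorem sameLorentz_W {φ : QuasiConcave} {X : RIQuasiBanach} (hX : IsOptimalRange φ X) :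
    ∃ h : dilG 1 ∈ X.space, SameLorentz (X.W h) φ := by
  obtain ⟨A, hA⟩ := optRange_embeds hX.1
  obtain ⟨B, hB⟩ := hX.2 _ (hardyBounded_optRange φ)
  have hmem : ∀ t, 0 < t → dilG t ∈ X.space := fun t ht => (hA _ (dilG_mem_optRange φ ht)).1
  refine ⟨hmem 1 one_pos, sameLorentz_of_le (A := A) (B := 3 * B) (fun t ht => ?_) fun t ht => ?_⟩
  · change (X.nrm (dilG t)).toReal ≤ _
    refine ENNReal.toReal_le_of_le_ofReal (mul_nonneg A.coe_nonneg (φ.pos t ht).le) ?_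
    rw [ENNReal.ofReal_mul A.coe_nonneg, ENNReal.ofReal_coe_nnreal]
    exact (hA _ (dilG_mem_optRange φ ht)).2.trans (mul_le_mul_right (optNorm_dilG_le φ ht) _)
  · change φ.toFun t ≤ _ * (X.nrm (dilG t)).toReal
    have h1 : ENNReal.ofReal (φ.toFun t) ≤ (3 * B : ℝ≥0) * X.nrm (dilG t) := by
      refine (le_optNorm_dilG φ ht).trans ?_
      rw [ENNReal.coe_mul, mul_assoc]
      exact mul_le_mul_right (hB _ (hmem t ht)).2 _
    have h2 := (ENNReal.ofReal_le_iff_le_toReal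
      (ENNReal.mul_ne_top ENNReal.coe_ne_top (hmem t ht).2.ne)).1 h1
    rwa [ENNReal.toReal_mul, ENNReal.coe_toReal] at h2

end

end RestrictedType

theorem theorem3p3 (φ : RestrictedType.QuasiConcave) :
    (∃ X : RestrictedType.RIQuasiBanach, RestrictedType.IsOptimalRange φ X) ∧
    ∀ X : RestrictedType.RIQuasiBanach, RestrictedType.IsOptimalRange φ X →
      ∃ h : RestrictedType.dilG 1 ∈ X.space, RestrictedType.SameLorentz (X.W h) φ :=
  ⟨⟨_, RestrictedType.isOptimalRange_optRange φ⟩, fun _ hX => RestrictedType.sameLorentz_W hX⟩
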